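/- Let $G$ be a finite connected simple undirected graph with $N_0$ vertices and $E_0$ edges. For an integer $n\ge 2$, let the $n$-polygon graph $\tau_n(G)$ be the graph obtained from $G$ by keeping all edges of $G$ and adding, for each edge $ij$ of $G$, a path of length $n$ from $i$ to $j$ (with $n-1$ new interior vertices), so that each edge of $G$ becomes an edge of an $(n+1)$-polygon; let $\tau_n^0(G)=G$ and $\tau_n^g(G)=\tau_n(\tau_n^{g-1}(G))$ for $g\ge 1$. Let $N_{st}(H)$ denote the number of spanning trees of a graph $H$. Then, for every $n\ge 2$, $$N_{st}(\tau_n(G))=(n+1)^{N_0-1}\,n^{E_0-N_0+1}\,N_{st}(G),$$ and, for every $n\ge 2$ and $g\ge 1$, $$N_{st}(\tau_n^g(G))=(n+1)^{\frac{(n-1)[(n+1)^g-ng-1]}{n^2}E_0+gN_0-g}\cdot n^{\frac{(n+1)^g+(n-1)ng-1}{n^2}E_0-gN_0+g}\cdot N_{st}(G).$$ -/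

import Mathlib

universe u

namespace PolygonGraph

/-- The number of spanning trees of `G`: the number of trees on the full vertex set of `G` all of
whose edges are edges of `G`. -/
noncomputable def numSpanningTrees {V : Type u} (G : SimpleGraph V) : ℕ :=
  Nat.card {T : SimpleGraph V // T ≤ G ∧ T.IsTree}

/-- The vertices of the `n`-polygon graph of `G`: the vertices of `G`, together with `n - 1` new
vertices for every edge of `G` (the interior vertices of the path added to that edge). -/
abbrev PolygonVertex (n : ℕ) {V : Type u} (G : SimpleGraph V) : Type u :=
  V ⊕ (G.edgeSet × Fin (n - 1))

/-- The `k`-th vertex (`0 ≤ k ≤ n`) of the path of length `n` added to the edge `e`. Vertices `0`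
and `n` of the path are the two ends of `e`, taken in an arbitrary chosen order; vertices
`1, …, n - 1` are new. The other order only reverses the path. -/
noncomputable def pathVertex (n : ℕ) {V : Type u} (G : SimpleGraph V) (e : G.edgeSet) (k : ℕ) :
    PolygonVertex n G :=
  if k = 0 then Sum.inl (Quot.out e.1).1
  else if h : k - 1 < n - 1 then Sum.inr (e, ⟨k - 1, h⟩)
  else Sum.inl (Quot.out e.1).2

/-- The `n`-polygon graph `τ_n(G)` (meant for `n ≥ 2`): all edges of `G` are kept, and to every
edge of `G` a path of length `n` joining its two ends is added. -/
def polygon (n : ℕ) {V : Type u} (G : SimpleGraph V) : SimpleGraph (PolygonVertex n G) :=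
  SimpleGraph.fromRel fun x y =>
    (∃ a b : V, G.Adj a b ∧ x = Sum.inl a ∧ y = Sum.inl b) ∨
    (∃ (e : G.edgeSet) (k : ℕ), k < n ∧ x = pathVertex n G e k ∧ y = pathVertex n G e (k + 1))

/-- The iterated `n`-polygon graph `τ_n^g(G)`, together with its vertex type:
`τ_n^0(G) = G` and `τ_n^(g+1)(G) = τ_n(τ_n^g(G))`. -/
def iterPolygonAux (n : ℕ) {V : Type u} (G : SimpleGraph V) : ℕ → (W : Type u) × SimpleGraph W
  | 0 => ⟨V, G⟩
  | g + 1 => ⟨PolygonVertex n (iterPolygonAux n G g).2, polygon n (iterPolygonAux n G g).2⟩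

/-- The vertex type of `τ_n^g(G)`. -/
abbrev IterPolygonVertex (n g : ℕ) {V : Type u} (G : SimpleGraph V) : Type u :=
  (iterPolygonAux n G g).1

/-- The iterated `n`-polygon graph `τ_n^g(G)`. -/
abbrev iterPolygon (n g : ℕ) {V : Type u} (G : SimpleGraph V) :
    SimpleGraph (IterPolygonVertex n g G) :=
  (iterPolygonAux n G g).2

end PolygonGraph

/-! Each edge of `polygon n G` lies in exactly one (n+1)-gon, one for each edge of G. A spanning
tree S meets each polygon either in all edges but one, so that the ends of the base edge are joined
inside it (n+1 choices), or in all path edges but one, without the base edge, so that they are not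
(n choices). The joined edges form a spanning tree A of G, and every A with every choice of such
traces arises (`isTree_gadget_iff`). Since |A| = N₀ - 1, each A has (n+1)^(N₀-1) n^(E₀-N₀+1) trees
above it (`card_traces_fiber`).

A tree is handled as a connected graph with the right number of edges, so cycles are never examined:
connectivity passes between S and A, and counting does the rest. The iterated formula follows by
induction, from the vertex and edge counts of the iterates. -/

namespace PolygonGraph

open SimpleGraph

/-! ### Spanning trees as finite sets of edge indices -/

section EdgeIndex

variable {W : Type*} {ι : Type*}

/-- The graph on `W` whose edges are the `ε i` with `i ∈ A`. -/
def edgeSubgraph (ε : ι → Sym2 W) (A : Finset ι) : SimpleGraph W :=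
  fromEdgeSet (ε '' (A : Set ι))

theorem edgeSubgraph_adj {ε : ι → Sym2 W} {A : Finset ι} {x y : W} :
    (edgeSubgraph ε A).Adj x y ↔ (∃ i ∈ A, ε i = s(x, y)) ∧ x ≠ y := by
  simp [edgeSubgraph]

theorem edgeSet_edgeSubgraph {H : SimpleGraph W} {ε : ι → Sym2 W}
    (hr : Set.range ε = H.edgeSet) (A : Finset ι) :
    (edgeSubgraph ε A).edgeSet = ε '' (A : Set ι) := by
  rw [edgeSubgraph, edgeSet_fromEdgeSet, sdiff_eq_left, Set.disjoint_left]
  rintro _ ⟨i, -, rfl⟩ hd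
  have : ε i ∈ H.edgeSet := hr ▸ Set.mem_range_self i
  exact H.not_isDiag_of_mem_edgeSet this hd

theorem card_edgeSet_edgeSubgraph {H : SimpleGraph W} {ε : ι → Sym2 W}
    (hr : Set.range ε = H.edgeSet) (hi : Function.Injective ε) (A : Finset ι) :
    Nat.card (edgeSubgraph ε A).edgeSet = A.card := by
  rw [edgeSet_edgeSubgraph hr, Nat.card_image_of_injective hi]
  simp

theorem isTree_edgeSubgraph_iff [Finite W] {H : SimpleGraph W} {ε : ι → Sym2 W}
    (hr : Set.range ε = H.edgeSet) (hi : Function.Injective ε) (A : Finset ι) :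
    (edgeSubgraph ε A).IsTree ↔
      (edgeSubgraph ε A).Connected ∧ A.card + 1 = Nat.card W := by
  rw [isTree_iff_connected_and_card, card_edgeSet_edgeSubgraph hr hi]

theorem edgeSubgraph_univ [Fintype ι] {H : SimpleGraph W} {ε : ι → Sym2 W}
    (hr : Set.range ε = H.edgeSet) : edgeSubgraph ε Finset.univ = H := by
  rw [edgeSubgraph, Finset.coe_univ, Set.image_univ, hr, fromEdgeSet_edgeSet]

theorem numSpanningTrees_eq_card [Finite ι] {H : SimpleGraph W} {ε : ι → Sym2 W}
    (hr : Set.range ε = H.edgeSet) (hi : Function.Injective ε) :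
    numSpanningTrees H = Nat.card {A : Finset ι // (edgeSubgraph ε A).IsTree} := by
  symm
  refine Nat.card_eq_of_bijective
    (fun A => ⟨edgeSubgraph ε A.1, ?_, A.2⟩) ⟨?_, ?_⟩
  · rw [← edgeSet_subset_edgeSet, edgeSet_edgeSubgraph hr, ← hr]
    exact Set.image_subset_range _ _
  · rintro ⟨A, hA⟩ ⟨B, hB⟩ h
    have h' : edgeSubgraph ε A = edgeSubgraph ε B := congrArg Subtype.val h
    rw [← edgeSet_inj, edgeSet_edgeSubgraph hr, edgeSet_edgeSubgraph hr] at h'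
    exact Subtype.ext (Finset.coe_injective (hi.image_injective h'))
  · rintro ⟨T, hT, hT'⟩
    have key : edgeSubgraph ε (Set.toFinite (ε ⁻¹' T.edgeSet)).toFinset = T := by
      rw [← edgeSet_inj, edgeSet_edgeSubgraph hr, Set.Finite.coe_toFinset,
        Set.image_preimage_eq_inter_range, hr, Set.inter_eq_left]
      exact edgeSet_subset_edgeSet.2 hT
    exact ⟨⟨_, key.symm ▸ hT'⟩, Subtype.ext key⟩

end EdgeIndex

/-! ### Edges of the polygon graph, indexed by base edge and position -/

section Gadget

variable {V : Type u} {n : ℕ} {G : SimpleGraph V}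

theorem mk_out (e : Sym2 V) : s((Quot.out e).1, (Quot.out e).2) = e :=
  Quot.out_eq e

theorem out_adj (e : G.edgeSet) : G.Adj (Quot.out e.1).1 (Quot.out e.1).2 := by
  rw [← mem_edgeSet, mk_out]
  exact e.2

theorem pathVertex_zero (e : G.edgeSet) :
    pathVertex n G e 0 = Sum.inl (Quot.out e.1).1 := by
  simp [pathVertex]

theorem pathVertex_self (hn : 1 ≤ n) (e : G.edgeSet) :
    pathVertex n G e n = Sum.inl (Quot.out e.1).2 := by
  rw [pathVertex, if_neg (by omega), dif_neg (by omega)]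

theorem pathVertex_interior (e : G.edgeSet) {k : ℕ} (h0 : 0 < k) (h : k < n) :
    pathVertex n G e k = Sum.inr (e, ⟨k - 1, by omega⟩) := by
  rw [pathVertex, if_neg (by omega), dif_pos (by omega)]

theorem pathVertex_succ (e : G.edgeSet) (i : Fin (n - 1)) :
    pathVertex n G e (i + 1) = Sum.inr (e, i) := by
  rw [pathVertex_interior e (by omega) (by omega)]
  simp

theorem pathVertex_eq_inr {e e' : G.edgeSet} {k : ℕ} {i : Fin (n - 1)}
    (h : pathVertex n G e k = Sum.inr (e', i)) : e = e' ∧ k = i + 1 := by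
  unfold pathVertex at h
  split_ifs at h with h1 h2
  simp only [Sum.inr.injEq, Prod.mk.injEq] at h
  obtain ⟨h3, rfl⟩ := h
  exact ⟨h3, by simp; omega⟩

theorem pathVertex_inj (e : G.edgeSet) {k l : ℕ} (hk : k ≤ n) (hl : l ≤ n)
    (h : pathVertex n G e k = pathVertex n G e l) : k = l := by
  have hne := (out_adj e).ne
  unfold pathVertex at h
  split_ifs at h <;> simp_all <;> omega

/-- The edges of the polygon through `e`: for `k < n` the `k`-th edge of the path added to `e`,
for `k = n` the edge `e` itself. -/
noncomputable def gadgetEdge (n : ℕ) (G : SimpleGraph V) (p : G.edgeSet × Fin (n + 1)) :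
    Sym2 (PolygonVertex n G) :=
  if (p.2 : ℕ) < n then s(pathVertex n G p.1 p.2, pathVertex n G p.1 (p.2 + 1))
  else s(pathVertex n G p.1 0, pathVertex n G p.1 n)

theorem gadgetEdge_of_lt (e : G.edgeSet) {k : Fin (n + 1)} (h : (k : ℕ) < n) :
    gadgetEdge n G (e, k) = s(pathVertex n G e k, pathVertex n G e (k + 1)) :=
  if_pos h

theorem gadgetEdge_last (e : G.edgeSet) :
    gadgetEdge n G (e, Fin.last n) = s(pathVertex n G e 0, pathVertex n G e n) :=
  if_neg (by simp)

theorem gadgetEdge_last_eq_map (hn : 1 ≤ n) (e : G.edgeSet) :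
    gadgetEdge n G (e, Fin.last n) = Sym2.map Sum.inl e.1 := by
  rw [gadgetEdge_last, pathVertex_zero, pathVertex_self hn]
  conv_rhs => rw [← mk_out e.1]
  rfl

theorem eq_of_inr_mem_gadgetEdge (hn : 1 ≤ n) {e e' : G.edgeSet} {i : Fin (n - 1)}
    {k : Fin (n + 1)} (h : Sum.inr (e, i) ∈ gadgetEdge n G (e', k)) : (k : ℕ) < n ∧ e' = e := by
  by_cases hk : (k : ℕ) < n
  · rw [gadgetEdge_of_lt e' hk, Sym2.mem_iff] at h
    rcases h with h | h <;> exact ⟨hk, (pathVertex_eq_inr h.symm).1⟩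
  · rw [show k = Fin.last n from Fin.ext (by simp; omega), gadgetEdge_last, pathVertex_zero,
      pathVertex_self hn] at h
    simp at h

/-- An interior vertex identifies the polygon of a path edge. For n = 1 there is none, and the path
edge would coincide with the base edge. -/
theorem exists_inr_mem_gadgetEdge (hn : 2 ≤ n) (e : G.edgeSet) {k : Fin (n + 1)}
    (hk : (k : ℕ) < n) : ∃ i, Sum.inr (e, i) ∈ gadgetEdge n G (e, k) := by
  rw [gadgetEdge_of_lt e hk]
  by_cases h0 : (k : ℕ) = 0
  · rw [pathVertex_interior e (k := k + 1) (by omega) (by omega)]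
    exact ⟨_, Sym2.mem_mk_right _ _⟩
  · rw [pathVertex_interior e (k := k) (by omega) (by omega)]
    exact ⟨_, Sym2.mem_mk_left _ _⟩

theorem gadgetEdge_injective (hn : 2 ≤ n) : Function.Injective (gadgetEdge n G) := by
  have hn1 : 1 ≤ n := by omega
  rintro ⟨e, k⟩ ⟨e', k'⟩ h
  by_cases hk : (k : ℕ) < n
  · obtain ⟨i, hi⟩ := exists_inr_mem_gadgetEdge hn e hk
    rw [h] at hi
    obtain ⟨hk', rfl⟩ := eq_of_inr_mem_gadgetEdge hn1 hi
    rw [gadgetEdge_of_lt _ hk, gadgetEdge_of_lt _ hk', Sym2.eq_iff] at h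
    have : k = k' := by
      rcases h with ⟨h1, h2⟩ | ⟨h1, h2⟩
      · exact Fin.ext (pathVertex_inj _ hk.le hk'.le h1)
      · have a := pathVertex_inj _ hk.le hk' h1
        have b := pathVertex_inj _ hk hk'.le h2
        omega
    rw [this]
  · obtain rfl : k = Fin.last n := Fin.ext (by simp; omega)
    by_cases hk' : (k' : ℕ) < n
    · obtain ⟨i, hi⟩ := exists_inr_mem_gadgetEdge hn e' hk'
      rw [← h] at hi
      exact absurd (eq_of_inr_mem_gadgetEdge hn1 hi).1 (by simp)
    · obtain rfl : k' = Fin.last n := Fin.ext (by simp; omega)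
      rw [gadgetEdge_last_eq_map hn1, gadgetEdge_last_eq_map hn1] at h
      rw [Subtype.ext (Sym2.map.injective Sum.inl_injective h)]

theorem range_gadgetEdge (hn : 1 ≤ n) : Set.range (gadgetEdge n G) = (polygon n G).edgeSet := by
  ext z
  induction z using Sym2.ind with | _ x y
  rw [mem_edgeSet, polygon, fromRel_adj]
  constructor
  · rintro ⟨⟨e, k⟩, h⟩
    by_cases hk : (k : ℕ) < n
    · rw [gadgetEdge_of_lt e hk] at h
      have hne : pathVertex n G e k ≠ pathVertex n G e (k + 1) := fun h' => by
        have := pathVertex_inj e hk.le hk h'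
        omega
      rcases Sym2.eq_iff.1 h with ⟨rfl, rfl⟩ | ⟨rfl, rfl⟩
      · exact ⟨hne, .inl (.inr ⟨e, k, hk, rfl, rfl⟩)⟩
      · exact ⟨hne.symm, .inr (.inr ⟨e, k, hk, rfl, rfl⟩)⟩
    · obtain rfl : k = Fin.last n := Fin.ext (by simp; omega)
      rw [gadgetEdge_last, pathVertex_zero, pathVertex_self hn] at h
      have ha := out_adj e
      rcases Sym2.eq_iff.1 h with ⟨rfl, rfl⟩ | ⟨rfl, rfl⟩
      · exact ⟨fun h => ha.ne (Sum.inl_injective h), .inl (.inl ⟨_, _, ha, rfl, rfl⟩)⟩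
      · exact ⟨fun h => ha.ne (Sum.inl_injective h.symm), .inr (.inl ⟨_, _, ha, rfl, rfl⟩)⟩
  · have key : ∀ x y : PolygonVertex n G,
        ((∃ a b : V, G.Adj a b ∧ x = Sum.inl a ∧ y = Sum.inl b) ∨
        (∃ (e : G.edgeSet) (k : ℕ), k < n ∧ x = pathVertex n G e k ∧
          y = pathVertex n G e (k + 1))) → s(x, y) ∈ Set.range (gadgetEdge n G) := by
      rintro x y (⟨a, b, hab, rfl, rfl⟩ | ⟨e, k, hk, rfl, rfl⟩)
      · exact ⟨(⟨s(a, b), hab⟩, Fin.last n), gadgetEdge_last_eq_map hn _⟩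
      · exact ⟨(e, ⟨k, by omega⟩), gadgetEdge_of_lt e hk⟩
    rintro ⟨-, h | h⟩
    · exact key x y h
    · rw [Sym2.eq_swap]
      exact key y x h

end Gadget

theorem reachable_induction {W : Type*} {H : SimpleGraph W} {P : W → Prop}
    (hP : ∀ x y, H.Adj x y → P x → P y) {x y : W} (h : H.Reachable x y) : P x → P y := by
  obtain ⟨w⟩ := h
  induction w with
  | nil => exact id
  | cons hadj _ ih => exact fun hx => ih (hP _ _ hadj hx)

/-! ### Connectivity of S versus connectivity of its joined edges -/

section Connectivity

variable {V : Type u} {n : ℕ} {G : SimpleGraph V}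

/-- The indices of the edges of the polygon through `e` that belong to `S`. -/
def slice [DecidableEq G.edgeSet] (S : Finset (G.edgeSet × Fin (n + 1))) (e : G.edgeSet) :
    Finset (Fin (n + 1)) :=
  Finset.univ.filter fun k => (e, k) ∈ S

/-- The ends of an edge are joined inside its polygon by the edges with index in `s`. -/
def Joins (s : Finset (Fin (n + 1))) : Prop :=
  Fin.last n ∈ s ∨ ∀ k : Fin (n + 1), (k : ℕ) < n → k ∈ s

open Classical in
/-- The edges of `G` whose ends are joined inside their polygon by edges of `S`. -/
noncomputable def joinedEdges [Fintype G.edgeSet] (S : Finset (G.edgeSet × Fin (n + 1))) :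
    Finset G.edgeSet :=
  Finset.univ.filter fun e => Joins (slice S e)

theorem mem_slice [DecidableEq G.edgeSet] {S : Finset (G.edgeSet × Fin (n + 1))} {e : G.edgeSet}
    {k : Fin (n + 1)} : k ∈ slice S e ↔ (e, k) ∈ S := by
  simp [slice]

variable [DecidableEq G.edgeSet]

theorem mem_joinedEdges [Fintype G.edgeSet] {S : Finset (G.edgeSet × Fin (n + 1))}
    {e : G.edgeSet} : e ∈ joinedEdges S ↔ Joins (slice S e) := by
  simp only [joinedEdges, Finset.mem_filter, Finset.mem_univ, true_and]
  convert Iff.rfl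

/-- Cut each path at a missing edge, if there is one, and collapse the two pieces onto the ends of
e. This map π fixes V and sends adjacent vertices to vertices reachable through joined edges. -/
theorem connected_joinedEdges [Fintype G.edgeSet] (hn : 1 ≤ n)
    {S : Finset (G.edgeSet × Fin (n + 1))}
    (h : (edgeSubgraph (gadgetEdge n G) S).Connected) :
    (edgeSubgraph (Subtype.val : G.edgeSet → Sym2 V) (joinedEdges S)).Connected := by
  set T := edgeSubgraph (Subtype.val : G.edgeSet → Sym2 V) (joinedEdges S) with hT
  -- The cut position; 0 is a harmless default when the whole path lies in S, as e is then joined.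
  have hcut : ∀ e : G.edgeSet, ∃ m < n, (∃ k : Fin (n + 1), (k : ℕ) < n ∧ k ∉ slice S e) →
      ∃ k : Fin (n + 1), (k : ℕ) = m ∧ k ∉ slice S e := by
    intro e
    by_cases he : ∃ k : Fin (n + 1), (k : ℕ) < n ∧ k ∉ slice S e
    · obtain ⟨k, hk, hk'⟩ := he
      exact ⟨k, hk, fun _ => ⟨k, rfl, hk'⟩⟩
    · exact ⟨0, hn, fun h => absurd h he⟩
  choose m hmn hm using hcut
  let π : PolygonVertex n G → V := Sum.elim id fun p =>
    if (p.2 : ℕ) + 1 ≤ m p.1 then (Quot.out p.1.1).1 else (Quot.out p.1.1).2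
  have hπ : ∀ (e : G.edgeSet) (k : ℕ), k ≤ n → π (pathVertex n G e k) =
      if k ≤ m e then (Quot.out e.1).1 else (Quot.out e.1).2 := by
    intro e k hk
    have hme := hmn e
    rcases Nat.eq_zero_or_pos k with rfl | h0
    · simp [pathVertex_zero, π]
    · rcases hk.eq_or_lt with rfl | hk
      · rw [pathVertex_self hn, if_neg (by omega)]
        rfl
      · rw [pathVertex_interior e h0 hk]
        simp only [π, Sum.elim_inr]
        rw [Nat.sub_add_cancel h0]
  have hjoin : ∀ e ∈ joinedEdges S, T.Reachable (Quot.out e.1).1 (Quot.out e.1).2 := by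
    intro e he
    refine Adj.reachable (edgeSubgraph_adj.2 ⟨⟨e, he, (mk_out e.1).symm⟩, (out_adj e).ne⟩)
  have hgadget : ∀ e : G.edgeSet, ∀ k l : ℕ, k ≤ n → l ≤ n →
      (e ∈ joinedEdges S ∨ (k ≤ m e ↔ l ≤ m e)) →
      T.Reachable (π (pathVertex n G e k)) (π (pathVertex n G e l)) := by
    intro e k l hk hl h
    rw [hπ e k hk, hπ e l hl]
    rcases h with h | h
    · split_ifs
      · exact Reachable.refl _
      · exact hjoin e h
      · exact (hjoin e h).symm
      · exact Reachable.refl _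
    · simp only [h]
      exact Reachable.refl _
  have hstep : ∀ x y, (edgeSubgraph (gadgetEdge n G) S).Adj x y → T.Reachable (π x) (π y) := by
    intro x y hxy
    obtain ⟨⟨⟨e, k⟩, hS, h⟩, -⟩ := edgeSubgraph_adj.1 hxy
    by_cases hk : (k : ℕ) < n
    · have key : T.Reachable (π (pathVertex n G e k)) (π (pathVertex n G e (k + 1))) := by
        refine hgadget e k (k + 1) hk.le hk ?_
        by_cases hkm : (k : ℕ) = m e
        -- The edge at the cut lies in S only if no path edge is missing.
        · refine .inl (mem_joinedEdges.2 (.inr fun l hl => ?_))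
          by_contra hl'
          obtain ⟨k', hk', hk''⟩ := hm e ⟨l, hl, hl'⟩
          rw [← hkm] at hk'
          rw [Fin.ext hk'] at hk''
          exact hk'' (mem_slice.2 hS)
        · right
          omega
      rw [gadgetEdge_of_lt e hk] at h
      rcases Sym2.eq_iff.1 h with ⟨rfl, rfl⟩ | ⟨rfl, rfl⟩
      · exact key
      · exact key.symm
    · obtain rfl : k = Fin.last n := Fin.ext (by simp; omega)
      have key : T.Reachable (π (pathVertex n G e 0)) (π (pathVertex n G e n)) :=
        hgadget e 0 n (by omega) le_rfl (.inl (mem_joinedEdges.2 (.inl (mem_slice.2 hS))))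
      rw [gadgetEdge_last] at h
      rcases Sym2.eq_iff.1 h with ⟨rfl, rfl⟩ | ⟨rfl, rfl⟩
      · exact key
      · exact key.symm
  have := h.nonempty.map π
  refine Connected.mk fun a b => ?_
  exact reachable_induction (P := fun z => T.Reachable a (π z))
    (fun x y hxy hx => hx.trans (hstep x y hxy)) (h.preconnected (Sum.inl a) (Sum.inl b))
    (Reachable.refl _)

/-- If path edges i < j were both missing, the vertices i+1, …, j, all interior, would be cut off
from the rest. -/
theorem exists_forall_mem_slice (hn : 1 ≤ n) {S : Finset (G.edgeSet × Fin (n + 1))}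
    (h : (edgeSubgraph (gadgetEdge n G) S).Connected) (e : G.edgeSet) :
    ∃ m : Fin (n + 1), ∀ k : Fin (n + 1), (k : ℕ) < n → k ≠ m → k ∈ slice S e := by
  by_contra! hcon
  obtain ⟨i, hin, -, hi⟩ := hcon (Fin.last n)
  obtain ⟨j, hjn, hij, hj⟩ := hcon i
  rw [mem_slice] at hi hj
  wlog hlt : i < j generalizing i j
  · exact this j hjn hj i hin hij.symm hi (lt_of_le_of_ne (not_lt.1 hlt) hij)
  have hlt' : (i : ℕ) < j := hlt
  have hclosed : ∀ x y, (edgeSubgraph (gadgetEdge n G) S).Adj x y →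
      (∃ l : ℕ, i < l ∧ l ≤ j ∧ x = pathVertex n G e l) →
      ∃ l : ℕ, i < l ∧ l ≤ j ∧ y = pathVertex n G e l := by
    rintro x y hxy ⟨l, hil, hlj, rfl⟩
    obtain ⟨⟨⟨e', k⟩, hS, heq⟩, -⟩ := edgeSubgraph_adj.1 hxy
    have hmem : pathVertex n G e l ∈ gadgetEdge n G (e', k) := heq ▸ Sym2.mem_mk_left _ _
    rw [pathVertex_interior e (by omega) (by omega)] at hmem
    obtain ⟨hk, rfl⟩ := eq_of_inr_mem_gadgetEdge hn hmem
    rw [gadgetEdge_of_lt _ hk] at heq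
    have hki : (k : ℕ) ≠ i := fun h => hi (Fin.ext h ▸ hS)
    have hkj : (k : ℕ) ≠ j := fun h => hj (Fin.ext h ▸ hS)
    rcases Sym2.eq_iff.1 heq with ⟨h1, rfl⟩ | ⟨rfl, h1⟩
    · have := pathVertex_inj _ hk.le (by omega) h1
      exact ⟨k + 1, by omega, by omega, rfl⟩
    · have := pathVertex_inj _ hk (by omega) h1
      exact ⟨k, by omega, by omega, rfl⟩
  obtain ⟨l, h1, h2, h3⟩ := reachable_induction hclosed
    (h.preconnected (pathVertex n G e j) (pathVertex n G e 0)) ⟨j, hlt', le_rfl, rfl⟩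
  have := pathVertex_inj e (by omega) (by omega) h3
  omega

theorem connected_of_joinedEdges [Fintype G.edgeSet] (hn : 1 ≤ n)
    {S : Finset (G.edgeSet × Fin (n + 1))}
    (h : (edgeSubgraph (Subtype.val : G.edgeSet → Sym2 V) (joinedEdges S)).Connected)
    (hS : ∀ e, ∃ m : Fin (n + 1), ∀ k : Fin (n + 1), (k : ℕ) < n → k ≠ m → k ∈ slice S e) :
    (edgeSubgraph (gadgetEdge n G) S).Connected := by
  set H := edgeSubgraph (gadgetEdge n G) S with hH
  have hne : ∀ (e : G.edgeSet) (k l : ℕ), k ≤ n → l ≤ n → k ≠ l →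
      pathVertex n G e k ≠ pathVertex n G e l :=
    fun e k l hk hl hkl heq => hkl (pathVertex_inj e hk hl heq)
  have hstep : ∀ (e : G.edgeSet) (k : Fin (n + 1)), (k : ℕ) < n → k ∈ slice S e →
      H.Reachable (pathVertex n G e k) (pathVertex n G e (k + 1)) := fun e k hk hkS =>
    Adj.reachable (edgeSubgraph_adj.2
      ⟨⟨(e, k), mem_slice.1 hkS, gadgetEdge_of_lt e hk⟩, hne _ _ _ hk.le hk (by omega)⟩)
  have hpath : ∀ (e : G.edgeSet) (a b : ℕ), a ≤ b → b ≤ n →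
      (∀ k : Fin (n + 1), a ≤ (k : ℕ) → (k : ℕ) < b → k ∈ slice S e) →
      H.Reachable (pathVertex n G e a) (pathVertex n G e b) := by
    intro e a b hab
    induction b, hab using Nat.le_induction with
    | base => exact fun _ _ => Reachable.refl _
    | succ b hab ih =>
      intro hb hk
      exact (ih (by omega) fun k h1 h2 => hk k h1 (by omega)).trans
        (hstep e ⟨b, by omega⟩ hb (hk _ hab (by simp)))
  have hends : ∀ e ∈ joinedEdges S,
      H.Reachable (pathVertex n G e 0) (pathVertex n G e n) := by
    intro e he
    rcases mem_joinedEdges.1 he with h1 | h1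
    · exact Adj.reachable (edgeSubgraph_adj.2
        ⟨⟨(e, Fin.last n), mem_slice.1 h1, gadgetEdge_last e⟩,
          hne _ _ _ (by omega) le_rfl (by omega)⟩)
    · exact hpath e 0 n (by omega) le_rfl fun k _ hk => h1 k hk
  have hbase : ∀ a b : V, H.Reachable (Sum.inl a) (Sum.inl b) := by
    intro a b
    refine reachable_induction (P := fun z => H.Reachable (Sum.inl a) (Sum.inl z)) ?_
      (h.preconnected a b) (Reachable.refl _)
    intro x y hxy hx
    refine hx.trans ?_
    obtain ⟨⟨e, he, heq⟩, -⟩ := edgeSubgraph_adj.1 hxy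
    have key := hends e he
    rw [pathVertex_zero, pathVertex_self hn] at key
    rw [← mk_out e.1] at heq
    rcases Sym2.eq_iff.1 heq with ⟨rfl, rfl⟩ | ⟨rfl, rfl⟩
    · exact key
    · exact key.symm
  have htobase : ∀ x : PolygonVertex n G, ∃ a : V, H.Reachable x (Sum.inl a) := by
    rintro (a | ⟨e, i⟩)
    · exact ⟨a, Reachable.refl _⟩
    · obtain ⟨m, hm⟩ := hS e
      rw [← pathVertex_succ]
      -- Walk to the end of the path on the side away from the missing edge m.
      by_cases him : (i : ℕ) + 1 ≤ m
      · refine ⟨_, pathVertex_zero e ▸ (hpath e 0 (i + 1) (by omega) (by omega) ?_).symm⟩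
        exact fun k _ hk => hm k (by omega) fun h => by subst h; omega
      · refine ⟨_, pathVertex_self hn e ▸ hpath e (i + 1) n (by omega) le_rfl ?_⟩
        exact fun k hk hkn => hm k hkn fun h => by subst h; omega
  have := h.nonempty.map (Sum.inl : V → PolygonVertex n G)
  refine Connected.mk fun x y => ?_
  obtain ⟨a, ha⟩ := htobase x
  obtain ⟨b, hb⟩ := htobase y
  exact ha.trans ((hbase a b).trans hb.symm)

end Connectivity

/-! ### Traces on a polygon and the one-step count -/

section Counting

variable {n : ℕ}

/-- The possible traces of a spanning tree on a polygon, according to whether the trace joins the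
ends of the base edge. -/
def traces (n : ℕ) (b : Prop) [Decidable b] : Finset (Finset (Fin (n + 1))) :=
  if b then Finset.powersetCard n Finset.univ
  else Finset.powersetCard (n - 1) (Finset.univ.erase (Fin.last n))

theorem card_traces (hn : 1 ≤ n) (b : Prop) [Decidable b] :
    (traces n b).card = if b then n + 1 else n := by
  unfold traces
  split_ifs
  · simp
  · rw [Finset.card_powersetCard, Finset.card_erase_of_mem (Finset.mem_univ _), Finset.card_fin,
      Nat.add_sub_cancel]
    obtain ⟨m, rfl⟩ : ∃ m, n = m + 1 := ⟨n - 1, by omega⟩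
    simp

theorem exists_forall_mem_of_mem_traces {b : Prop} [Decidable b] {s : Finset (Fin (n + 1))}
    (hs : s ∈ traces n b) :
    ∃ m : Fin (n + 1), ∀ k : Fin (n + 1), (k : ℕ) < n → k ≠ m → k ∈ s := by
  have hcard : ((Finset.univ.erase (Fin.last n)) \ s).card ≤ 1 := by
    unfold traces at hs
    split_ifs at hs
    · have h := (Finset.mem_powersetCard.1 hs).2
      calc ((Finset.univ.erase (Fin.last n)) \ s).card ≤ (Finset.univ \ s).card :=
            Finset.card_le_card (Finset.sdiff_subset_sdiff (Finset.erase_subset _ _) le_rfl)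
        _ ≤ 1 := by
            rw [Finset.card_sdiff_of_subset (Finset.subset_univ _), Finset.card_fin]
            omega
    · obtain ⟨h1, h2⟩ := Finset.mem_powersetCard.1 hs
      rw [Finset.card_sdiff_of_subset h1, Finset.card_erase_of_mem (Finset.mem_univ _),
        Finset.card_fin]
      omega
  rw [Finset.card_le_one_iff_subset_singleton] at hcard
  obtain ⟨m, hm⟩ := hcard
  refine ⟨m, fun k hk hkm => ?_⟩
  by_contra hks
  have : k ∈ ({m} : Finset (Fin (n + 1))) := by
    refine hm (Finset.mem_sdiff.2 ⟨Finset.mem_erase.2 ⟨?_, Finset.mem_univ _⟩, hks⟩)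
    rintro rfl
    simp at hk
  exact hkm (Finset.mem_singleton.1 this)

theorem joins_iff_of_mem_traces (hn : 1 ≤ n) {b : Prop} [Decidable b] {s : Finset (Fin (n + 1))}
    (hs : s ∈ traces n b) : Joins s ↔ b := by
  have hsub : (∀ k : Fin (n + 1), (k : ℕ) < n → k ∈ s) →
      Finset.univ.erase (Fin.last n) ⊆ s := by
    intro h k hk
    exact h k (Fin.val_lt_last (Finset.mem_erase.1 hk).1)
  have hce : (Finset.univ.erase (Fin.last n)).card = n := by
    rw [Finset.card_erase_of_mem (Finset.mem_univ _), Finset.card_fin, Nat.add_sub_cancel]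
  unfold traces at hs
  split_ifs at hs with hb
  · refine iff_of_true ?_ hb
    by_cases hl : Fin.last n ∈ s
    · exact .inl hl
    · right
      have h := (Finset.mem_powersetCard.1 hs).2
      have : s = Finset.univ.erase (Fin.last n) := by
        refine Finset.eq_of_subset_of_card_le
          (fun k hk => Finset.mem_erase.2 ⟨fun h => hl (h ▸ hk), Finset.mem_univ _⟩) ?_
        rw [h, hce]
      rw [this]
      intro k hk
      refine Finset.mem_erase.2 ⟨?_, Finset.mem_univ _⟩
      rintro rfl
      simp at hk
  · refine iff_of_false ?_ hb
    obtain ⟨h1, h2⟩ := Finset.mem_powersetCard.1 hs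
    rintro (h | h)
    · exact Finset.notMem_erase _ _ (h1 h)
    · have := Finset.card_le_card (hsub h)
      omega

theorem card_of_mem_traces {b : Prop} [Decidable b] (hn : 1 ≤ n) {s : Finset (Fin (n + 1))}
    (hs : s ∈ traces n b) : s.card = n - 1 + if b then 1 else 0 := by
  unfold traces at hs
  split_ifs at hs ⊢
  · have := (Finset.mem_powersetCard.1 hs).2
    omega
  · exact (Finset.mem_powersetCard.1 hs).2

/-- The local lower bound whose sum over all polygons is tight exactly for trees. -/
theorem le_card_of_forall_mem (hn : 1 ≤ n) {s : Finset (Fin (n + 1))} [Decidable (Joins s)]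
    (hs : ∃ m : Fin (n + 1), ∀ k : Fin (n + 1), (k : ℕ) < n → k ≠ m → k ∈ s) :
    n - 1 + (if Joins s then 1 else 0) ≤ s.card := by
  obtain ⟨m, hm⟩ := hs
  have hlt : ∀ k : Fin (n + 1), k ≠ Fin.last n → (k : ℕ) < n := fun k hk => Fin.val_lt_last hk
  split_ifs with hj
  · obtain ⟨c, hc⟩ : ∃ c : Fin (n + 1), Finset.univ.erase c ⊆ s := by
      rcases hj with h | h
      · refine ⟨m, fun k hk => ?_⟩
        by_cases hkl : k = Fin.last n
        · exact hkl ▸ h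
        · exact hm k (hlt k hkl) (Finset.mem_erase.1 hk).1
      · exact ⟨Fin.last n, fun k hk => h k (hlt k (Finset.mem_erase.1 hk).1)⟩
    have h := Finset.card_le_card hc
    rw [Finset.card_erase_of_mem (Finset.mem_univ _), Finset.card_fin] at h
    omega
  · have hc : (Finset.univ.erase (Fin.last n)).erase m ⊆ s := by
      intro k hk
      simp only [Finset.mem_erase, Finset.mem_univ, and_true] at hk
      exact hm k (hlt k hk.2) hk.1
    have h := Finset.card_le_card hc
    have h2 := Finset.pred_card_le_card_erase (s := Finset.univ.erase (Fin.last n)) (a := m)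
    rw [Finset.card_erase_of_mem (Finset.mem_univ _), Finset.card_fin] at h2
    omega

theorem mem_traces_of_card {s : Finset (Fin (n + 1))} {b : Prop} [Decidable b] (hn : 1 ≤ n)
    (hb : Joins s ↔ b) (hs : s.card = n - 1 + if b then 1 else 0) : s ∈ traces n b := by
  unfold traces
  split_ifs at hs ⊢ with h
  · exact Finset.mem_powersetCard.2 ⟨Finset.subset_univ _, by omega⟩
  · refine Finset.mem_powersetCard.2 ⟨fun k hk => ?_, hs⟩
    refine Finset.mem_erase.2 ⟨fun hkl => h (hb.1 (.inl (hkl ▸ hk))), Finset.mem_univ _⟩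

variable {V : Type u} {G : SimpleGraph V}

theorem card_eq_sum_slice [Fintype G.edgeSet] [DecidableEq G.edgeSet]
    (S : Finset (G.edgeSet × Fin (n + 1))) : S.card = ∑ e, (slice S e).card := by
  rw [Finset.card_eq_sum_card_fiberwise (f := Prod.fst) (t := Finset.univ)
    (fun _ _ => Finset.mem_coe.2 (Finset.mem_univ _))]
  refine Finset.sum_congr rfl fun e _ => ?_
  symm
  refine Finset.card_bij (fun k _ => (e, k)) ?_ ?_ ?_
  · intro k hk
    simpa using mem_slice.1 hk
  · intro a _ b _ h
    exact (Prod.mk.inj h).2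
  · rintro ⟨e', k⟩ h
    obtain ⟨h1, rfl⟩ := Finset.mem_filter.1 h
    exact ⟨k, mem_slice.2 h1, rfl⟩

theorem card_polygonVertex [Finite V] (n : ℕ) :
    Nat.card (PolygonVertex n G) = Nat.card V + Nat.card G.edgeSet * (n - 1) := by
  rw [Nat.card_sum, Nat.card_prod, Nat.card_fin]

theorem natCard_subtype_eq_card_filter {α : Type*} [Fintype α] (p : α → Prop) [DecidablePred p] :
    Nat.card {a // p a} = (Finset.univ.filter p).card := by
  rw [Nat.card_eq_fintype_card, Fintype.card_subtype]

open Classical in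
-- If S is connected, each slice has at least n - 1 edges, one more when joined, and the connected
-- graph on V has at least |V| - 1 joined edges. The edge count of a tree leaves no slack, so all
-- these bounds are equalities.
theorem isTree_gadget_iff [Finite V] [Fintype G.edgeSet] (hn : 2 ≤ n)
    (S : Finset (G.edgeSet × Fin (n + 1))) :
    (edgeSubgraph (gadgetEdge n G) S).IsTree ↔
      (edgeSubgraph (Subtype.val : G.edgeSet → Sym2 V) (joinedEdges S)).IsTree ∧
        ∀ e, slice S e ∈ traces n (e ∈ joinedEdges S) := by
  have hn1 : 1 ≤ n := by omega
  have hsum : ∑ e, (n - 1 + if e ∈ joinedEdges S then 1 else 0) =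
      Nat.card G.edgeSet * (n - 1) + (joinedEdges S).card := by
    rw [Finset.sum_add_distrib, Finset.sum_boole, Finset.sum_const, Finset.card_univ,
      Nat.card_eq_fintype_card, smul_eq_mul]
    simp
  rw [isTree_edgeSubgraph_iff (range_gadgetEdge hn1) (gadgetEdge_injective hn),
    isTree_edgeSubgraph_iff Subtype.range_val Subtype.val_injective, card_polygonVertex,
    card_eq_sum_slice]
  constructor
  · rintro ⟨hconn, hcard⟩
    have hbase := connected_joinedEdges hn1 hconn
    have hle : ∀ e ∈ Finset.univ, (n - 1 + if e ∈ joinedEdges S then 1 else 0) ≤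
        (slice S e).card := by
      intro e _
      have := le_card_of_forall_mem hn1 (exists_forall_mem_slice hn1 hconn e)
      simpa only [mem_joinedEdges] using this
    have hV := hbase.card_vert_le_card_edgeSet_add_one
    rw [card_edgeSet_edgeSubgraph Subtype.range_val Subtype.val_injective] at hV
    have htot := Finset.sum_le_sum hle
    have heq := (Finset.sum_eq_sum_iff_of_le hle).1 (by omega)
    refine ⟨⟨hbase, by omega⟩, fun e => ?_⟩
    exact mem_traces_of_card hn1 mem_joinedEdges.symm (heq e (Finset.mem_univ e)).symm
  · rintro ⟨⟨hconn, hcard⟩, htr⟩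
    refine ⟨connected_of_joinedEdges hn1 hconn fun e =>
      exists_forall_mem_of_mem_traces (htr e), ?_⟩
    rw [Finset.sum_congr rfl fun e _ => card_of_mem_traces hn1 (htr e), hsum]
    omega

open Classical in
-- S is the same as its family of slices, which may be chosen independently; the traces already
-- force `joinedEdges S = A`.
theorem card_traces_fiber [Fintype G.edgeSet] (hn : 1 ≤ n) (A : Finset G.edgeSet) :
    (Finset.univ.filter fun S : Finset (G.edgeSet × Fin (n + 1)) =>
      joinedEdges S = A ∧ ∀ e, slice S e ∈ traces n (e ∈ A)).card =
      (n + 1) ^ A.card * n ^ (Nat.card G.edgeSet - A.card) := by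
  have hpi : (Fintype.piFinset fun e : G.edgeSet => traces n (e ∈ A)).card =
      (n + 1) ^ A.card * n ^ (Nat.card G.edgeSet - A.card) := by
    rw [Fintype.card_piFinset]
    simp only [card_traces hn]
    rw [Finset.prod_ite, Finset.prod_const, Finset.prod_const, Finset.filter_mem_eq_inter,
      Finset.univ_inter, Finset.filter_not, Finset.filter_mem_eq_inter, Finset.univ_inter,
      Finset.card_sdiff_of_subset (Finset.subset_univ _), Finset.card_univ,
      Nat.card_eq_fintype_card]
  rw [← hpi]
  refine Finset.card_bij (fun S _ => slice S) ?_ ?_ ?_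
  · intro S hS
    exact Fintype.mem_piFinset.2 (Finset.mem_filter.1 hS).2.2
  · intro S _ S' _ h
    ext ⟨e, k⟩
    rw [← mem_slice, ← mem_slice, h]
  · intro f hf
    rw [Fintype.mem_piFinset] at hf
    have hslice : slice (Finset.univ.filter fun p : G.edgeSet × Fin (n + 1) => p.2 ∈ f p.1) = f := by
      ext e k
      simp [mem_slice]
    refine ⟨_, Finset.mem_filter.2 ⟨Finset.mem_univ _, ?_, ?_⟩, hslice⟩
    · ext e
      rw [mem_joinedEdges, hslice, joins_iff_of_mem_traces hn (hf e)]
    · rw [hslice]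
      exact hf

/-- Spanning trees are fibred over `joinedEdges`. Truncated subtraction is harmless: a spanning tree
of G makes the exponents exact, and without one both sides vanish. -/
theorem numSpanningTrees_polygon [Finite V] (hn : 2 ≤ n) :
    numSpanningTrees (polygon n G) = (n + 1) ^ (Nat.card V - 1) *
      n ^ (Nat.card G.edgeSet + 1 - Nat.card V) * numSpanningTrees G := by
  classical
  have hn1 : 1 ≤ n := by omega
  have := Fintype.ofFinite G.edgeSet
  rw [numSpanningTrees_eq_card (range_gadgetEdge hn1) (gadgetEdge_injective hn),
    numSpanningTrees_eq_card (H := G) Subtype.range_val Subtype.val_injective,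
    natCard_subtype_eq_card_filter fun S : Finset (G.edgeSet × Fin (n + 1)) =>
      (edgeSubgraph (gadgetEdge n G) S).IsTree,
    natCard_subtype_eq_card_filter fun A : Finset G.edgeSet =>
      (edgeSubgraph (Subtype.val : G.edgeSet → Sym2 V) A).IsTree, Finset.card_eq_sum_card_fiberwise (f := joinedEdges) (t :=
      Finset.univ.filter fun A : Finset G.edgeSet =>
        (edgeSubgraph (Subtype.val : G.edgeSet → Sym2 V) A).IsTree),
    mul_comm, ← smul_eq_mul, ← Finset.sum_const]
  · refine Finset.sum_congr rfl fun A hA => ?_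
    have hA' := (Finset.mem_filter.1 hA).2
    have hcard := ((isTree_edgeSubgraph_iff Subtype.range_val Subtype.val_injective A).1 hA').2
    rw [show Nat.card V - 1 = A.card by omega,
      show Nat.card G.edgeSet + 1 - Nat.card V = Nat.card G.edgeSet - A.card by omega,
      ← card_traces_fiber hn1 A, Finset.filter_filter]
    congr 1
    refine Finset.filter_congr fun S _ => ?_
    rw [isTree_gadget_iff hn]
    constructor
    · rintro ⟨⟨-, h⟩, rfl⟩
      exact ⟨rfl, h⟩
    · rintro ⟨rfl, h⟩
      exact ⟨⟨hA', h⟩, rfl⟩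
  · intro S hS
    simp only [Finset.coe_filter, Finset.mem_univ, true_and, Set.mem_ofPred_eq] at hS ⊢
    exact ((isTree_gadget_iff hn S).1 hS).1

theorem card_edgeSet_polygon (hn : 2 ≤ n) :
    Nat.card (polygon n G).edgeSet = Nat.card G.edgeSet * (n + 1) := by
  rw [← range_gadgetEdge (by omega : 1 ≤ n), ← Set.image_univ,
    Nat.card_image_of_injective (gadgetEdge_injective hn)]
  simp [Nat.card_prod]

theorem connected_polygon [Finite V] (hn : 1 ≤ n) (hG : G.Connected) :
    (polygon n G).Connected := by
  classical
  have := Fintype.ofFinite G.edgeSet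
  have hall : ∀ (e : G.edgeSet) (k : Fin (n + 1)), k ∈ slice Finset.univ e := by
    simp [mem_slice]
  rw [← edgeSubgraph_univ (range_gadgetEdge hn)]
  refine connected_of_joinedEdges hn ?_ fun e => ⟨0, fun k _ _ => hall e k⟩
  have : joinedEdges (Finset.univ : Finset (G.edgeSet × Fin (n + 1))) = Finset.univ :=
    Finset.eq_univ_iff_forall.2 fun e => mem_joinedEdges.2 (.inl (hall e _))
  rwa [this, edgeSubgraph_univ Subtype.range_val]

end Counting

/-! ### Real exponents and iteration -/

section Iteration

variable {V : Type u} {n : ℕ} {G : SimpleGraph V}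

theorem numSpanningTrees_polygon_rpow [Finite V] (hn : 2 ≤ n) (hG : G.Connected) :
    (numSpanningTrees (polygon n G) : ℝ) =
      ((n : ℝ) + 1) ^ ((Nat.card V : ℝ) - 1) *
        (n : ℝ) ^ ((Nat.card G.edgeSet : ℝ) - (Nat.card V : ℝ) + 1) *
          (numSpanningTrees G : ℝ) := by
  have := hG.nonempty
  have h1 : 1 ≤ Nat.card V := Nat.card_pos
  have h2 := hG.card_vert_le_card_edgeSet_add_one
  rw [numSpanningTrees_polygon hn]
  push_cast
  rw [← Real.rpow_natCast, ← Real.rpow_natCast, Nat.cast_sub h1, Nat.cast_sub h2]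
  push_cast
  ring_nf

theorem finite_iterPolygonVertex [Finite V] (n g : ℕ) (G : SimpleGraph V) :
    Finite (IterPolygonVertex n g G) := by
  induction g with
  | zero => assumption
  | succ g ih =>
    have := ih
    exact inferInstanceAs (Finite (PolygonVertex n (iterPolygon n g G)))

theorem connected_iterPolygon [Finite V] (hn : 1 ≤ n) (hG : G.Connected) (g : ℕ) :
    (iterPolygon n g G).Connected := by
  induction g with
  | zero => exact hG
  | succ g ih =>
    have := finite_iterPolygonVertex n g G
    exact connected_polygon hn ih

theorem card_edgeSet_iterPolygon (hn : 2 ≤ n) (g : ℕ) :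
    Nat.card (iterPolygon n g G).edgeSet = Nat.card G.edgeSet * (n + 1) ^ g := by
  induction g with
  | zero =>
    simp
    rfl
  | succ g ih =>
    rw [pow_succ, ← mul_assoc, ← ih]
    exact card_edgeSet_polygon hn

/-- Step k + 1 adds (n-1)E₀(n+1)^k vertices; this is the geometric sum. -/
theorem card_iterPolygonVertex [Finite V] (hn : 2 ≤ n) (g : ℕ) :
    (Nat.card (IterPolygonVertex n g G) : ℝ) = (Nat.card V : ℝ) +
      ((n : ℝ) - 1) * Nat.card G.edgeSet * (((n : ℝ) + 1) ^ g - 1) / n := by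
  have hn0 : (n : ℝ) ≠ 0 := by
    norm_cast
    omega
  induction g with
  | zero =>
    simp
    rfl
  | succ g ih =>
    have := finite_iterPolygonVertex n g G
    have h : Nat.card (IterPolygonVertex n (g + 1) G) = _ :=
      card_polygonVertex (G := iterPolygon n g G) n
    rw [h, card_edgeSet_iterPolygon hn]
    push_cast
    rw [ih, Nat.cast_sub (by omega)]
    field_simp
    push_cast
    ring

theorem numSpanningTrees_iterPolygon_rpow [Finite V] (hn : 2 ≤ n) (hG : G.Connected) (g : ℕ) :
    (numSpanningTrees (iterPolygon n g G) : ℝ) =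
      ((n : ℝ) + 1) ^
          (((n : ℝ) - 1) * (((n : ℝ) + 1) ^ g - (n : ℝ) * (g : ℝ) - 1) / (n : ℝ) ^ 2 *
              (Nat.card G.edgeSet : ℝ)
            + (g : ℝ) * (Nat.card V : ℝ) - (g : ℝ)) *
        (n : ℝ) ^
          ((((n : ℝ) + 1) ^ g + ((n : ℝ) - 1) * (n : ℝ) * (g : ℝ) - 1) / (n : ℝ) ^ 2 *
              (Nat.card G.edgeSet : ℝ)
            - (g : ℝ) * (Nat.card V : ℝ) + (g : ℝ)) *
        (numSpanningTrees G : ℝ) := by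
  have hn0 : (0 : ℝ) < n := by
    norm_cast
    omega
  induction g with
  | zero =>
    simp
    rfl
  | succ g ih =>
    have := finite_iterPolygonVertex n g G
    have h : (numSpanningTrees (iterPolygon n (g + 1) G) : ℝ) = _ :=
      numSpanningTrees_polygon_rpow hn (connected_iterPolygon (by omega) hG g)
    rw [h, ih, card_edgeSet_iterPolygon hn, card_iterPolygonVertex hn, ← mul_assoc, mul_mul_mul_comm,
      ← Real.rpow_add (by positivity), ← Real.rpow_add hn0]
    -- What remains is one additive recurrence for each exponent.
    congr 3
    · push_cast
      field_simp
      ring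
    · push_cast
      field_simp
      ring

end Iteration

end PolygonGraph

theorem theorem5 {V : Type u} [Finite V] (G : SimpleGraph V) (hG : G.Connected)
    (N₀ E₀ : ℕ) (hN₀ : N₀ = Nat.card V) (hE₀ : E₀ = Nat.card G.edgeSet)
    (n : ℕ) (hn : 2 ≤ n) :
    (PolygonGraph.numSpanningTrees (PolygonGraph.polygon n G) : ℝ) =
        ((n : ℝ) + 1) ^ ((N₀ : ℝ) - 1) * (n : ℝ) ^ ((E₀ : ℝ) - (N₀ : ℝ) + 1) *
          (PolygonGraph.numSpanningTrees G : ℝ) ∧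
    ∀ g : ℕ, 1 ≤ g →
      (PolygonGraph.numSpanningTrees (PolygonGraph.iterPolygon n g G) : ℝ) =
        ((n : ℝ) + 1) ^
            (((n : ℝ) - 1) * (((n : ℝ) + 1) ^ g - (n : ℝ) * (g : ℝ) - 1) / (n : ℝ) ^ 2 * (E₀ : ℝ)
              + (g : ℝ) * (N₀ : ℝ) - (g : ℝ)) *
          (n : ℝ) ^
            ((((n : ℝ) + 1) ^ g + ((n : ℝ) - 1) * (n : ℝ) * (g : ℝ) - 1) / (n : ℝ) ^ 2 * (E₀ : ℝ)
              - (g : ℝ) * (N₀ : ℝ) + (g : ℝ)) *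
          (PolygonGraph.numSpanningTrees G : ℝ) := by
  subst hN₀ hE₀
  exact ⟨PolygonGraph.numSpanningTrees_polygon_rpow hn hG,
    fun g _ => PolygonGraph.numSpanningTrees_iterPolygon_rpow hn hG g⟩
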